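/- Let $\lambda,\mu_d,t>0$, and let $b$ and $w$, $b>w$, be fixed positive integers. Let $(N_s)_{s\ge 0}$ (blocks found by a mining pool) and $(M^d_s)_{s\ge 0}$ (shares submitted in the pool that are not blocks) be independent homogeneous Poisson processes with intensities $\lambda$ and $\mu_d$. Every share, block or not, costs the pool manager $w$, and every block earns $b$, so that with initial capital $u$ her surplus is $$R_s=u-(M^d_s+N_s)\,w+N_s\,b,\qquad s\ge 0.$$ Let $\tau=\inf\{s\ge 0: R_s<0\}$ (with $\inf\emptyset=\infty$) be the time of ruin, let $\psi(u,s)=\mathbb P(\tau\le s)$, and let $\widehat\psi(u,t)=\mathbb E[\psi(u,T)]$, where $T$ is exponentially distributed with mean $t$, be the ruin probability up to an exponential time horizon with mean $t$. Then the equation $$\lambda x^{b}-\Big(\lambda+\mu_d+\frac1t\Big)x^{w}+\mu_d=0$$ has, counted with multiplicity, exactly $w$ complex roots $x_1,\dots,x_w$ in the open unit disk $\{|x|<1\}$; they are distinct; the system of linear equations $$\sum_{i=1}^{w}\Big(\lambda x_i^{\,b-w+j}-\Big(\lambda+\mu_d+\frac1t\Big)x_i^{\,j}\Big)c_i=-\mu_d,\qquad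 j=0,1,\dots,w-1,$$ has exactly one solution $(c_1,\dots,c_w)\in\mathbb C^w$; and for every integer $u\ge 0$ $$\widehat\psi(u,t)=\sum_{i=1}^{w}c_i\,x_i^{u}.$$ -/

import Mathlib

open MeasureTheory ProbabilityTheory Polynomial
open scoped NNReal ENNReal Matrix

namespace MiningPool

/-- A homogeneous Poisson process with intensity `r` on the probability space `(Ω, P)`: a counting
process with independent, Poisson distributed increments, starting at `0`, whose paths are almost
surely non-decreasing and right-continuous. (The paths being non-decreasing, the differences of
natural numbers below are honest ones, almost surely.) -/
structure IsPoissonProcess {Ω : Type*} [MeasurableSpace Ω]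
    (N : ℝ≥0 → Ω → ℕ) (r : ℝ≥0) (P : Measure Ω) : Prop where
  measurable : ∀ s, Measurable (N s)
  zero : ∀ᵐ ω ∂P, N 0 ω = 0
  mono : ∀ᵐ ω ∂P, Monotone fun s => N s ω
  rightCts : ∀ᵐ ω ∂P, ∀ s, ContinuousWithinAt (fun v => N v ω) (Set.Ici s) s
  indepIncrements : HasIndepIncrements N P
  law : ∀ s v : ℝ≥0, s ≤ v →
    HasLaw (fun ω => N v ω - N s ω) (poissonMeasure (r * (v - s))) P

noncomputable section

/-- The surplus `R_s = u - M_s w + N_s b` of the pool manager. Here `N` counts the blocks found by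
the pool, `D` counts the shares that are not blocks, and `M = D + N` counts all the shares. -/
def surplus {Ω : Type*} (b w : ℕ) (N D : ℝ≥0 → Ω → ℕ) (u : ℝ) (s : ℝ≥0) (ω : Ω) : ℝ :=
  u - ((D s ω + N s ω : ℕ) : ℝ) * w + (N s ω : ℝ) * b

/-- The time of ruin `τ = inf {s ≥ 0 : R_s < 0}`; it is `∞` if ruin never occurs. -/
def ruinTime {Ω : Type*} (b w : ℕ) (N D : ℝ≥0 → Ω → ℕ) (u : ℝ) (ω : Ω) : ℝ≥0∞ :=
  sInf {a : ℝ≥0∞ | ∃ s : ℝ≥0, a = s ∧ surplus b w N D u s ω < 0}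

/-- The ruin probability `ψ(u, s) = P(τ ≤ s)` up to the time `s ≥ 0`. -/
def ruinProb {Ω : Type*} [MeasurableSpace Ω] (P : Measure Ω) (b w : ℕ)
    (N D : ℝ≥0 → Ω → ℕ) (u s : ℝ) : ℝ :=
  P.real {ω | ruinTime b w N D u ω ≤ ENNReal.ofReal s}

/-- The ruin probability `E[ψ(u, T)]` up to an exponential time `T` with mean `t`,
that is, with rate `1 / t`. -/
def expRuinProb {Ω : Type*} [MeasurableSpace Ω] (P : Measure Ω) (b w : ℕ)
    (N D : ℝ≥0 → Ω → ℕ) (u t : ℝ) : ℝ :=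
  ∫ s, ruinProb P b w N D u s ∂(expMeasure (1 / t))

/-- The polynomial `l x^b - (l + m + 1/t) x^w + m` of the characteristic equation. -/
def charPoly (b w : ℕ) (l m t : ℝ) : ℂ[X] :=
  C (l : ℂ) * X ^ b - C ((l + m + 1 / t : ℝ) : ℂ) * X ^ w + C (m : ℂ)

/-- The roots of the characteristic equation in the open unit disk, with multiplicity. -/
def rootsInDisk (b w : ℕ) (l m t : ℝ) : Multiset ℂ := by
  classical exact (charPoly b w l m t).roots.filter fun z => ‖z‖ < 1

/-- The matrix with the entry `l x_i^(b-w+j) - (l + m + 1/t) x_i^j` in row `j` and column `i`,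
for `0 ≤ j < w`. -/
def systemMatrix (b w : ℕ) (l m t : ℝ) (x : Fin w → ℂ) : Matrix (Fin w) (Fin w) ℂ :=
  Matrix.of fun j i =>
    (l : ℂ) * x i ^ (b - w + (j : ℕ)) - ((l + m + 1 / t : ℝ) : ℂ) * x i ^ (j : ℕ)

end

end MiningPool

/-! Write `k = λ + μ_d + 1/t` and `f u` for the ruin probability up to the exponential horizon.
Looking at a short initial time gives `k f(u) = λ f(u+b-w) + μ_d f(u-w)` for `u ≥ 0`, with `f = 1`
on negative capitals (`expRuinProb_firstStep`). Since `λ + μ_d < k`, the equation is a contraction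
for the sup norm and has at most one bounded solution (`eq_zero_of_bounded_of_recursion`).

A power `x^u` satisfies the equation for `u ≥ w` exactly when `x` is a nonzero root of the
characteristic polynomial, and is bounded if `|x| < 1`. For a combination of such powers, the
equations at `u < w` are the linear system. So any solution `c` of the system yields `f`.

On the unit circle the term `-k x^w` dominates the others, so Rouché's theorem gives `w` roots in
the disk. A double root `z` would make `|z|` a minimum point, with value `0`, of `λ y^b - k y^w +
μ_d` on the positive axis, although this function is `-1/t` at `1`. For distinct nonzero roots the
system matrix is a Vandermonde matrix times an invertible diagonal one.

The first-step equation needs no differentiability in the time horizon. The one-step expansion has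
error `O(h^2)`, is averaged over the exponential horizon by memorylessness, and only then compared
to first order at `h = 0` (`integral_expMeasure_of_infinitesimal`). -/

namespace MiningPool

/-! ### Roots of the characteristic equation in the unit disk -/

section Roots

/-- The argument principle for a polynomial on the unit circle. -/
lemma circleIntegral_derivative_div_eval (p : ℂ[X]) (hp : ∀ z : ℂ, ‖z‖ = 1 → p.eval z ≠ 0)
    [DecidablePred fun z : ℂ => ‖z‖ < 1] :
    CircleIntegrable (fun z => p.derivative.eval z / p.eval z) 0 1 ∧
    (∮ z in C(0, 1), p.derivative.eval z / p.eval z) =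
      2 * Real.pi * Complex.I * (p.roots.filter fun z => ‖z‖ < 1).card := by
  have hp0 : p ≠ 0 := by
    rintro rfl
    exact hp 1 (by simp) (by simp)
  -- The logarithmic derivative is the sum of `1 / (z - r)` over the roots; each term integrates to
  -- `2πi` or `0` according to the side of the circle on which `r` lies.
  have key : ∀ s : Multiset ℂ, (∀ r ∈ s, ‖r‖ ≠ 1) →
      CircleIntegrable (fun z => (s.map fun r => 1 / (z - r)).sum) 0 1 ∧
      (∮ z in C(0, 1), (s.map fun r => 1 / (z - r)).sum) =
        2 * Real.pi * Complex.I * (s.filter fun z => ‖z‖ < 1).card := by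
    intro s
    induction s using Multiset.induction_on with
    | empty => intro _; simp [circleIntegral]
    | cons a s ih =>
      intro h
      obtain ⟨i1, i2⟩ := ih fun r hr => h r (Multiset.mem_cons_of_mem hr)
      have ha := h a (Multiset.mem_cons_self a s)
      have ia : CircleIntegrable (fun z => 1 / (z - a)) 0 1 := by
        simp only [one_div]
        rw [circleIntegrable_sub_inv_iff]
        simp [ha]
      have va : (∮ z in C(0, 1), 1 / (z - a)) =
          2 * Real.pi * Complex.I * (if ‖a‖ < 1 then 1 else 0) := by
        simp only [one_div]
        split_ifs with hlt
        · rw [circleIntegral.integral_sub_inv_of_mem_ball (by simpa using hlt), mul_one]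
        · rw [mul_zero]
          have hne : ∀ z ∈ Metric.closedBall (0 : ℂ) 1, z - a ≠ 0 := by
            intro z hz h0
            rw [sub_eq_zero] at h0
            subst h0
            rw [mem_closedBall_zero_iff] at hz
            exact ha (le_antisymm hz (not_lt.1 hlt))
          refine Complex.circleIntegral_eq_zero_of_differentiable_on_off_countable zero_le_one
            Set.countable_empty (fun z hz => ?_) fun z hz => ?_
          · exact ContinuousAt.continuousWithinAt
              ((continuousAt_id.sub continuousAt_const).inv₀ (hne z hz))
          · exact (differentiableAt_id.sub_const a).inv
              (hne z (Metric.ball_subset_closedBall hz.1))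
      simp only [Multiset.map_cons, Multiset.sum_cons]
      refine ⟨ia.add i1, ?_⟩
      rw [circleIntegral.integral_add ia i1, va, i2, Multiset.filter_cons]
      split_ifs <;> simp; ring
  have hr : ∀ r ∈ p.roots, ‖r‖ ≠ 1 := fun r hr h1 =>
    hp r h1 ((mem_roots hp0).1 hr)
  obtain ⟨h1, h2⟩ := key p.roots hr
  have heq : Set.EqOn (fun z => (p.roots.map fun r => 1 / (z - r)).sum)
      (fun z => p.derivative.eval z / p.eval z) (Metric.sphere 0 1) := fun z hz =>
    ((IsAlgClosed.splits p).eval_derivative_div_eval_of_ne_zero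
      (hp z (by simpa using hz))).symm
  refine ⟨h1.congr fun θ _ => heq (circleMap_mem_sphere 0 zero_le_one θ), ?_⟩
  rw [← h2]
  exact circleIntegral.integral_congr zero_le_one heq.symm

/-- Rouché's theorem for polynomials on the unit disk. -/
lemma card_roots_eq_of_norm_sub_lt (p q : ℂ[X])
    (h : ∀ z : ℂ, ‖z‖ = 1 → ‖p.eval z - q.eval z‖ < ‖q.eval z‖)
    [DecidablePred fun z : ℂ => ‖z‖ < 1] :
    (p.roots.filter fun z => ‖z‖ < 1).card = (q.roots.filter fun z => ‖z‖ < 1).card := by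
  have hq : ∀ z : ℂ, ‖z‖ = 1 → q.eval z ≠ 0 := fun z hz h0 => by
    have := h z hz
    rw [h0, norm_zero] at this
    exact absurd this (not_lt.2 (norm_nonneg _))
  have hp : ∀ z : ℂ, ‖z‖ = 1 → p.eval z ≠ 0 := fun z hz h0 => by
    have := h z hz
    rw [h0, zero_sub, norm_neg] at this
    exact lt_irrefl _ this
  obtain ⟨ip, vp⟩ := circleIntegral_derivative_div_eval p hp
  obtain ⟨iq, vq⟩ := circleIntegral_derivative_div_eval q hq
  have h0 : (∮ z in C(0, 1),
      (p.derivative.eval z / p.eval z - q.derivative.eval z / q.eval z)) = 0 := by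
    -- On the circle `p / q` stays within distance `1` of `1`, so the principal logarithm of `p / q`
    -- is a primitive of the integrand.
    refine circleIntegral.integral_eq_zero_of_hasDerivWithinAt
      (f := fun z => Complex.log (p.eval z / q.eval z)) zero_le_one fun z hz => ?_
    have hz1 : ‖z‖ = 1 := by simpa using hz
    have hs : p.eval z / q.eval z ∈ Complex.slitPlane := by
      refine Complex.ball_one_subset_slitPlane ?_
      rw [mem_ball_iff_norm]
      have : p.eval z / q.eval z - 1 = (p.eval z - q.eval z) / q.eval z := by
        field_simp [hq z hz1]
      rw [this, norm_div, div_lt_one (norm_pos_iff.2 (hq z hz1))]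
      exact h z hz1
    have hd := (((p.hasDerivAt z).fun_div (q.hasDerivAt z) (hq z hz1)).clog hs).hasDerivWithinAt
      (s := Metric.sphere (0 : ℂ) 1)
    convert hd using 1
    have := hp z hz1
    have := hq z hz1
    field_simp
  rw [circleIntegral.integral_sub ip iq, vp, vq, ← mul_sub, mul_eq_zero, sub_eq_zero] at h0
  rcases h0 with h0 | h0
  · exact absurd h0 Complex.two_pi_I_ne_zero
  · exact_mod_cast h0

variable {b w : ℕ} {l m t : ℝ}

lemma eval_charPoly (z : ℂ) : (charPoly b w l m t).eval z =
    l * z ^ b - ((l + m + 1 / t : ℝ) : ℂ) * z ^ w + m := by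
  simp [charPoly]

lemma charPoly_ne_zero (hm : 0 < m) (hw : 0 < w) (hbw : w < b) : charPoly b w l m t ≠ 0 := by
  intro h
  have := eval_charPoly (b := b) (w := w) (l := l) (m := m) (t := t) 0
  rw [h] at this
  simp [hw.ne', (hw.trans hbw).ne'] at this
  exact hm.ne (by exact_mod_cast this)

lemma mem_rootsInDisk (hm : 0 < m) (hw : 0 < w) (hbw : w < b) {z : ℂ} :
    z ∈ rootsInDisk b w l m t ↔ (charPoly b w l m t).eval z = 0 ∧ ‖z‖ < 1 := by
  have h0 := charPoly_ne_zero (b := b) (w := w) (l := l) (t := t) hm hw hbw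
  simp [rootsInDisk, h0]

lemma card_rootsInDisk (hl : 0 < l) (hm : 0 < m) (ht : 0 < t) :
    (rootsInDisk b w l m t).card = w := by
  classical
  have ht' : 0 < 1 / t := by positivity
  have hk : 0 < l + m + 1 / t := by positivity
  have := card_roots_eq_of_norm_sub_lt (charPoly b w l m t)
    (C (-((l + m + 1 / t : ℝ) : ℂ)) * X ^ w) fun z hz => by
      rw [eval_charPoly]
      simp only [eval_mul, eval_C, eval_pow, eval_X]
      calc ‖(l : ℂ) * z ^ b - ((l + m + 1 / t : ℝ) : ℂ) * z ^ w + m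
            - -((l + m + 1 / t : ℝ) : ℂ) * z ^ w‖ = ‖(l : ℂ) * z ^ b + m‖ := by
              congr 1; ring
        _ ≤ ‖(l : ℂ) * z ^ b‖ + ‖(m : ℂ)‖ := norm_add_le _ _
        _ = l + m := by simp [hz, abs_of_pos hl, abs_of_pos hm]
        _ < l + m + 1 / t := by linarith
        _ = ‖-((l + m + 1 / t : ℝ) : ℂ) * z ^ w‖ := by
              rw [norm_mul, norm_neg, Complex.norm_real, norm_pow, hz, one_pow, mul_one,
                Real.norm_of_nonneg hk.le]
  rw [rootsInDisk]
  convert this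
  rw [roots_C_mul_X_pow (by rw [neg_ne_zero]; exact_mod_cast hk.ne'), Multiset.filter_eq_self.2]
  · simp
  · intro a ha
    rw [Multiset.mem_nsmul] at ha
    simp_all

lemma nodup_rootsInDisk (hl : 0 < l) (hm : 0 < m) (ht : 0 < t) (hw : 0 < w) (hbw : w < b) :
    (rootsInDisk b w l m t).Nodup := by
  classical
  set k := l + m + 1 / t with hkdef
  have ht' : 0 < 1 / t := by positivity
  have hk : 0 < k := by positivity
  have hp0 := charPoly_ne_zero (b := b) (w := w) (l := l) (t := t) hm hw hbw
  rw [Multiset.nodup_iff_count_le_one]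
  intro z
  by_contra! hc
  have hz : z ∈ rootsInDisk b w l m t := Multiset.count_pos.1 (by omega)
  obtain ⟨hz0, hz1⟩ := (mem_rootsInDisk hm hw hbw).1 hz
  have hmult : 1 < (charPoly b w l m t).rootMultiplicity z := by
    rw [← count_roots]
    refine lt_of_lt_of_le hc (Multiset.count_le_of_le z ?_)
    rw [rootsInDisk]
    exact Multiset.filter_le _ _
  have hder : (charPoly b w l m t).derivative.eval z = 0 :=
    ((one_lt_rootMultiplicity_iff_isRoot hp0).1 hmult).2
  rw [eval_charPoly, ← hkdef] at hz0
  simp only [charPoly, ← hkdef, derivative_add, derivative_sub, derivative_C_mul_X_pow,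
    derivative_C, eval_sub, eval_mul, eval_C, eval_pow, eval_X,
    add_zero] at hder
  have hzne : z ≠ 0 := by
    rintro rfl
    simp [hw.ne', (hw.trans hbw).ne', hm.ne'] at hz0
  have hder' : (l : ℂ) * b * z ^ b = k * w * z ^ w := by
    have e1 : z ^ b = z ^ (b - 1) * z := by rw [← pow_succ]; congr 1; omega
    have e2 : z ^ w = z ^ (w - 1) * z := by rw [← pow_succ]; congr 1; omega
    rw [e1, e2]
    linear_combination z * hder
  have hbR : (0 : ℝ) < b := by exact_mod_cast hw.trans hbw
  have hwR : (0 : ℝ) < w := by exact_mod_cast hw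
  have hbwR : (w : ℝ) < b := by exact_mod_cast hbw
  set r := ‖z‖ with hr
  have hr0 : 0 < r := norm_pos_iff.2 hzne
  -- Both relations for `z` equate single terms with positive coefficients, so they survive taking
  -- norms: `r` is a double root of the real polynomial.
  have n1 : l * b * r ^ b = k * w * r ^ w := by
    have := congrArg norm hder'
    simpa [abs_of_pos hl, abs_of_pos hk] using this
  have n2 : k * (b - w) * r ^ w = b * m := by
    have e : (k : ℂ) * ((b - w : ℝ) : ℂ) * z ^ w = b * m := by
      push_cast
      linear_combination (-(b : ℂ)) * hz0 + hder'
    have := congrArg norm e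
    rw [norm_mul, norm_mul, norm_mul, norm_pow, Complex.norm_real, Complex.norm_real,
      Complex.norm_real, Complex.norm_natCast, Real.norm_of_nonneg hk.le,
      Real.norm_of_nonneg hm.le, Real.norm_of_nonneg (by linarith)] at this
    exact this
  -- The real function `l y ^ b - k y ^ w + m` has its minimum `0` at `r`, by Bernoulli's
  -- inequality; but it is negative at `1`.
  have bern : (b : ℝ) * (r⁻¹ ^ w) ≤ w * r⁻¹ ^ b + (b - w) := by
    have h1 := one_add_mul_self_le_rpow_one_add (s := r⁻¹ ^ w - 1) (p := b / w)
      (by have : 0 < r⁻¹ ^ w := by positivity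
          linarith) ((one_le_div hwR).2 hbwR.le)
    have h2 : (1 + (r⁻¹ ^ w - 1)) ^ ((b : ℝ) / w) = r⁻¹ ^ b := by
      rw [add_sub_cancel, ← Real.rpow_natCast, ← Real.rpow_mul (by positivity),
        mul_div_cancel₀ _ hwR.ne', Real.rpow_natCast]
    rw [h2] at h1
    have h3 := mul_le_mul_of_nonneg_left h1 hwR.le
    have h4 : (w : ℝ) * (1 + b / w * (r⁻¹ ^ w - 1)) = w + b * (r⁻¹ ^ w - 1) := by
      field_simp
    linarith
  have hl' : l * b = k * w * r ^ w * r⁻¹ ^ b := by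
    rw [← n1, inv_pow, mul_assoc, mul_inv_cancel₀ (by positivity), mul_one]
  have hk' : k = k * r ^ w * r⁻¹ ^ w := by
    rw [inv_pow, mul_assoc, mul_inv_cancel₀ (by positivity), mul_one]
  have h5 := mul_le_mul_of_nonneg_left bern (show 0 ≤ k * r ^ w by positivity)
  have h6 : b * k ≤ b * (l + m) := by
    calc b * k = k * r ^ w * (b * r⁻¹ ^ w) := by linear_combination b * hk'
      _ ≤ _ := h5
      _ = b * (l + m) := by linear_combination n2 - hl'
  have := le_of_mul_le_mul_left h6 hbR
  linarith

end Roots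

/-! ### The linear system and bounded solutions of the recursion -/

section LinearSystem

variable {b w : ℕ} {l m t : ℝ} {x : Fin w → ℂ}

/-- Dividing the root equation by `x_i^w` gives `l x_i^(b-w) - (l + m + 1/t) = -m / x_i^w`. Column
`i` is therefore this nonzero scalar times the powers of `x_i`. -/
lemma isUnit_det_systemMatrix (hm : 0 < m) (hbw : w ≤ b) (hx : Function.Injective x)
    (hroot : ∀ i, (charPoly b w l m t).eval (x i) = 0) (hx0 : ∀ i, x i ≠ 0) :
    IsUnit (systemMatrix b w l m t x).det := by
  have hmC : (m : ℂ) ≠ 0 := by exact_mod_cast hm.ne'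
  have hfac : systemMatrix b w l m t x =
      (Matrix.vandermonde x)ᵀ * Matrix.diagonal fun i => -(m : ℂ) / x i ^ w := by
    ext j i
    rw [Matrix.mul_diagonal, Matrix.transpose_apply, Matrix.vandermonde_apply]
    simp only [systemMatrix, Matrix.of_apply]
    have h := hroot i
    rw [eval_charPoly] at h
    have hb : x i ^ b = x i ^ (b - w) * x i ^ w := by rw [← pow_add, Nat.sub_add_cancel hbw]
    rw [hb] at h
    have := hx0 i
    rw [pow_add]
    field_simp
    linear_combination h
  rw [hfac, Matrix.det_mul, Matrix.det_transpose, Matrix.det_diagonal, isUnit_iff_ne_zero]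
  refine mul_ne_zero (Matrix.det_vandermonde_ne_zero_iff.2 hx) ?_
  exact Finset.prod_ne_zero_iff.2 fun i _ =>
    div_ne_zero (neg_ne_zero.2 hmC) (pow_ne_zero _ (hx0 i))

/-- The homogeneous first-step equation has no bounded solution but `0`: it is a contraction for the
sup norm. -/
lemma eq_zero_of_bounded_of_recursion {h : ℕ → ℂ} {B k : ℝ} (hl : 0 ≤ l) (hm : 0 ≤ m)
    (hk : l + m < k) (hB : ∀ u, ‖h u‖ ≤ B)
    (hrec : ∀ u, (k : ℂ) * h u = l * h (u + (b - w)) + m * (if u < w then 0 else h (u - w))) :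
    ∀ u, h u = 0 := by
  have hbdd : BddAbove (Set.range fun u => ‖h u‖) := ⟨B, by rintro _ ⟨u, rfl⟩; exact hB u⟩
  set S := ⨆ u, ‖h u‖ with hS
  have hle : ∀ u, ‖h u‖ ≤ S := fun u => le_ciSup hbdd u
  have hS0 : 0 ≤ S := (norm_nonneg _).trans (hle 0)
  have hkpos : 0 < k := by linarith
  have hstep : ∀ u, ‖h u‖ ≤ (l + m) * S / k := by
    intro u
    rw [le_div_iff₀ hkpos, mul_comm]
    calc k * ‖h u‖ = ‖(k : ℂ) * h u‖ := by
          rw [norm_mul, Complex.norm_real, Real.norm_of_nonneg hkpos.le]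
      _ ≤ ‖(l : ℂ) * h (u + (b - w))‖ + ‖(m : ℂ) * (if u < w then 0 else h (u - w))‖ := by
          rw [hrec]; exact norm_add_le _ _
      _ ≤ l * S + m * S := by
          rw [norm_mul, norm_mul, Complex.norm_real, Complex.norm_real, Real.norm_of_nonneg hl,
            Real.norm_of_nonneg hm]
          gcongr
          · exact hle _
          · split_ifs
            · simpa using hS0
            · exact hle _
      _ = (l + m) * S := by ring
  have hS1 : S ≤ (l + m) * S / k := ciSup_le hstep
  rw [le_div_iff₀ hkpos] at hS1
  have hS2 : S ≤ 0 := by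
    by_contra! hpos
    nlinarith
  intro u
  exact norm_le_zero_iff.1 ((hle u).trans hS2)

/-- Bounded solutions of the first-step equation are combinations of powers of the roots of the
characteristic equation in the unit disk; the coefficients solve the linear system. -/
theorem exists_unique_coeff_of_recursion (hl : 0 < l) (hm : 0 < m) (ht : 0 < t) (hw : 0 < w)
    (hbw : w < b) (hx : Finset.univ.val.map x = rootsInDisk b w l m t) {f : ℕ → ℝ} {B : ℝ}
    (hB : ∀ u, |f u| ≤ B)
    (hf : ∀ u, (l + m + 1 / t) * f u =
      l * f (u + (b - w)) + m * (if u < w then 1 else f (u - w))) :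
    ∃ c : Fin w → ℂ, systemMatrix b w l m t x *ᵥ c = (fun _ => -(m : ℂ)) ∧
      (∀ c' : Fin w → ℂ, systemMatrix b w l m t x *ᵥ c' = (fun _ => -(m : ℂ)) → c' = c) ∧
      ∀ u : ℕ, (f u : ℂ) = ∑ i, c i * x i ^ u := by
  have hmem : ∀ i, x i ∈ rootsInDisk b w l m t := fun i => by
    rw [← hx]; exact Multiset.mem_map_of_mem x (Finset.mem_univ i)
  have hroot : ∀ i, (charPoly b w l m t).eval (x i) = 0 := fun i =>
    ((mem_rootsInDisk hm hw hbw).1 (hmem i)).1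
  have hdisk : ∀ i, ‖x i‖ < 1 := fun i => ((mem_rootsInDisk hm hw hbw).1 (hmem i)).2
  have hx0 : ∀ i, x i ≠ 0 := fun i h0 => by
    have := hroot i
    rw [h0, eval_charPoly] at this
    simp [hw.ne', (hw.trans hbw).ne', hm.ne'] at this
  have hinj : Function.Injective x := fun i j hij =>
    Multiset.inj_on_of_nodup_map (hx ▸ nodup_rootsInDisk hl hm ht hw hbw)
      i (Finset.mem_univ i) j (Finset.mem_univ j) hij
  set A := systemMatrix b w l m t x with hA
  have hdet : IsUnit A.det := isUnit_det_systemMatrix hm hbw.le hinj hroot hx0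
  refine ⟨A⁻¹ *ᵥ fun _ => -(m : ℂ), ?_, fun c' hc' => ?_, ?_⟩
  · rw [Matrix.mulVec_mulVec, Matrix.mul_nonsing_inv A hdet, Matrix.one_mulVec]
  · rw [← hc', Matrix.mulVec_mulVec, Matrix.nonsing_inv_mul A hdet, Matrix.one_mulVec]
  set c := A⁻¹ *ᵥ fun _ => -(m : ℂ) with hc
  have hsys : A *ᵥ c = fun _ => -(m : ℂ) := by
    rw [hc, Matrix.mulVec_mulVec, Matrix.mul_nonsing_inv A hdet, Matrix.one_mulVec]
  set g : ℕ → ℂ := fun u => ∑ i, c i * x i ^ u with hg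
  have hgB : ∀ u, ‖g u‖ ≤ ∑ i, ‖c i‖ := fun u => by
    refine (norm_sum_le _ _).trans (Finset.sum_le_sum fun i _ => ?_)
    rw [norm_mul, norm_pow]
    exact mul_le_of_le_one_right (norm_nonneg _) (pow_le_one₀ (norm_nonneg _) (hdisk i).le)
  have hgrec : ∀ u, ((l + m + 1 / t : ℝ) : ℂ) * g u =
      l * g (u + (b - w)) + m * (if u < w then 1 else g (u - w)) := by
    intro u
    split_ifs with hu
    -- For `u < w` the recursion is row `u` of the system; for `u ≥ w` it holds term by term, as
    -- `x_i^(u-w)` times the root equation.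
    · have h := congrFun hsys ⟨u, hu⟩
      simp only [Matrix.mulVec, dotProduct, hA, systemMatrix, Matrix.of_apply] at h
      have h' : ∑ i, ((l : ℂ) * x i ^ (b - w + u) - ((l + m + 1 / t : ℝ) : ℂ) * x i ^ u) * c i =
          l * g (u + (b - w)) - ((l + m + 1 / t : ℝ) : ℂ) * g u := by
        simp only [hg, Finset.mul_sum, ← Finset.sum_sub_distrib]
        refine Finset.sum_congr rfl fun i _ => ?_
        rw [add_comm u]; ring
      rw [h'] at h
      linear_combination -h
    · simp only [hg, Finset.mul_sum, ← Finset.sum_add_distrib]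
      refine Finset.sum_congr rfl fun i _ => ?_
      have h := hroot i
      rw [eval_charPoly] at h
      have e1 : x i ^ u = x i ^ (u - w) * x i ^ w := by rw [← pow_add]; congr 1; omega
      have e2 : x i ^ (u + (b - w)) = x i ^ (u - w) * x i ^ b := by
        rw [← pow_add]; congr 1; omega
      rw [e1, e2]
      linear_combination (-(c i * x i ^ (u - w))) * h
  have hzero := eq_zero_of_bounded_of_recursion (b := b) (w := w) (h := fun u => f u - g u)
    (B := B + ∑ i, ‖c i‖) (k := l + m + 1 / t) hl.le hm.le
    (by have : 0 < 1 / t := by positivity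
        linarith)
    (fun u => (norm_sub_le _ _).trans (add_le_add (by simpa using hB u) (hgB u)))
    (fun u => by
      have h1 : ((l + m + 1 / t : ℝ) : ℂ) * f u =
          l * f (u + (b - w)) + m * (if u < w then 1 else f (u - w)) := by
        have := congrArg (fun r : ℝ => (r : ℂ)) (hf u)
        push_cast at this ⊢
        exact this
      have h2 := hgrec u
      split_ifs with hu
      · rw [if_pos hu] at h1 h2
        rw [Complex.ofReal_one] at h1
        linear_combination h1 - h2
      · rw [if_neg hu] at h1 h2
        linear_combination h1 - h2)
  intro u
  exact sub_eq_zero.1 (hzero u)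

end LinearSystem

/-! ### Stationarity and the Markov property of Poisson processes -/

section PoissonProcess

variable {Ω : Type*} [MeasurableSpace Ω] {P : Measure Ω} {X : ℝ≥0 → Ω → ℕ} {r : ℝ≥0}

/-- The increments of the process after the time `h`. -/
def shiftedBy (X : ℝ≥0 → Ω → ℕ) (h : ℝ≥0) (s : ℝ≥0) (ω : Ω) : ℕ := X (h + s) ω - X h ω

/-- Every finite set of times is covered by a monotone sequence of times. -/
lemma exists_monotone_seq_covering (I : Finset ℝ≥0) :
    ∃ s : ℕ → ℝ≥0, Monotone s ∧ s 0 = 0 ∧ ∃ k : I → ℕ, ∀ i, s (k i) = i := by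
  rcases I.eq_empty_or_nonempty with rfl | hI
  · exact ⟨fun _ => 0, monotone_const, rfl, fun _ => 0, fun i => absurd i.2 (Finset.notMem_empty _)⟩
  have hc : 0 < I.card := hI.card_pos
  set e := I.orderEmbOfFin rfl with he
  -- The sequence is `0`, then the elements of `I` in increasing order, then constant; prepending
  -- `0` shifts the indices by one.
  refine ⟨fun n => n.casesOn 0 fun j => e ⟨min j (I.card - 1), by omega⟩, ?_, rfl,
    fun i => ((I.orderIsoOfFin rfl).symm i : ℕ) + 1, fun i => ?_⟩
  · refine monotone_nat_of_le_succ fun n => ?_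
    cases n with
    | zero => simp
    | succ n => exact e.monotone (by simp only [Fin.mk_le_mk]; omega)
  · have hlt := ((I.orderIsoOfFin rfl).symm i).2
    have : (⟨min ((I.orderIsoOfFin rfl).symm i : ℕ) (I.card - 1), by omega⟩ : Fin I.card) =
        (I.orderIsoOfFin rfl).symm i := Fin.ext (by simp only []; omega)
    simp only [this, he, ← Finset.coe_orderIsoOfFin_apply, OrderIso.apply_symm_apply]

lemma IsPoissonProcess.measurable_shiftedBy (hX : IsPoissonProcess X r P) (h s : ℝ≥0) :
    Measurable (shiftedBy X h s) :=
  (hX.measurable _).sub (hX.measurable _)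

/-- The right-hand side is free of `h`: this is the stationarity that identifies the law of the
shifted process. -/
lemma IsPoissonProcess.map_increments [IsProbabilityMeasure P] (hX : IsPoissonProcess X r P)
    (h : ℝ≥0) {s : ℕ → ℝ≥0} (hs : Monotone s) :
    P.map (fun ω j => X (h + s (j + 1)) ω - X (h + s j) ω) =
      Measure.infinitePi fun j => poissonMeasure (r * (s (j + 1) - s j)) := by
  have hmono : Monotone fun j => h + s j := fun i j hij => by
    have := hs hij
    simp only
    gcongr
  refine (iIndepFun.hasLaw_infinitePi (fun j => ?_) (hX.indepIncrements.nat hmono)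
    (aemeasurable_pi_lambda _ fun j =>
      ((hX.measurable _).sub (hX.measurable _)).aemeasurable)).map_eq
  have := hX.law (h + s j) (h + s (j + 1)) (hmono (Nat.le_succ j))
  rwa [add_tsub_add_eq_tsub_left] at this

/-- The shifted process as a function of increments. -/
lemma IsPoissonProcess.shiftedBy_eq_sum (hX : IsPoissonProcess X r P)
    (h : ℝ≥0) {s : ℕ → ℝ≥0} (hs : Monotone s) (hs0 : s 0 = 0) :
    ∀ᵐ ω ∂P, ∀ n, shiftedBy X h (s n) ω =
      ∑ j ∈ Finset.range n, (X (h + s (j + 1)) ω - X (h + s j) ω) := by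
  filter_upwards [hX.mono] with ω hω n
  have hm : Monotone fun j => X (h + s j) ω := fun i j hij => by
    have := hs hij
    exact hω (by gcongr)
  rw [Finset.sum_range_tsub hm, hs0, add_zero, shiftedBy]

/-- The shifted process has the same law as the process itself. -/
lemma IsPoissonProcess.map_shiftedBy [IsProbabilityMeasure P] (hX : IsPoissonProcess X r P)
    (h : ℝ≥0) :
    P.map (fun ω s => shiftedBy X h s ω) = P.map (fun ω s => X s ω) := by
  -- The finite-dimensional laws are images of the law of the increments under partial summation,
  -- hence the same for every `h`.
  have hfd : ∀ (h : ℝ≥0) (I : Finset ℝ≥0) (s : ℕ → ℝ≥0), Monotone s → s 0 = 0 →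
      ∀ k : I → ℕ, (∀ i, s (k i) = i) →
      P.map (fun ω => I.restrict (shiftedBy X h · ω)) =
        (Measure.infinitePi fun j => poissonMeasure (r * (s (j + 1) - s j))).map
          fun y (i : I) => ∑ j ∈ Finset.range (k i), y j := by
    intro h I s hs hs0 k hk
    have hsum : Measurable fun (y : ℕ → ℕ) (i : I) => ∑ j ∈ Finset.range (k i), y j :=
      measurable_pi_lambda _ fun i => Finset.measurable_sum _ fun j _ => measurable_pi_apply j
    have hinc : Measurable fun ω j => X (h + s (j + 1)) ω - X (h + s j) ω :=
      measurable_pi_lambda _ fun j => (hX.measurable _).sub (hX.measurable _)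
    rw [← hX.map_increments h hs, Measure.map_map hsum hinc]
    refine Measure.map_congr ?_
    filter_upwards [hX.shiftedBy_eq_sum h hs hs0] with ω hω
    funext i
    have := hω (k i)
    rw [hk] at this
    exact this
  have h1 : P.map (fun ω s => shiftedBy X h s ω) = P.map (fun ω s => shiftedBy X 0 s ω) := by
    refine (map_eq_iff_forall_finset_map_restrict_eq
      (measurable_pi_lambda _ (hX.measurable_shiftedBy h)).aemeasurable
      (measurable_pi_lambda _ (hX.measurable_shiftedBy 0)).aemeasurable).2 fun I => ?_
    obtain ⟨s, hs, hs0, k, hk⟩ := exists_monotone_seq_covering I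
    rw [hfd h I s hs hs0 k hk, hfd 0 I s hs hs0 k hk]
  rw [h1]
  refine Measure.map_congr ?_
  filter_upwards [hX.zero] with ω hω
  funext s
  simp [shiftedBy, hω]

/-- The Markov property at a fixed time. -/
lemma IsPoissonProcess.indepFun_shiftedBy [IsProbabilityMeasure P] (hX : IsPoissonProcess X r P)
    (h : ℝ≥0) : IndepFun (X h) (fun ω s => shiftedBy X h s ω) P := by
  refine IndepFun.indepFun_process (hX.measurable h) (hX.measurable_shiftedBy h) fun I => ?_
  obtain ⟨s, hs, hs0, k, hk⟩ := exists_monotone_seq_covering I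
  -- Since `s 0 = 0`, the first increment along `τ` is almost surely `X h`, and the later ones are
  -- those of the shifted process.
  set τ : ℕ → ℝ≥0 := fun n => n.casesOn 0 fun j => h + s j with hτ
  have hτm : Monotone τ := by
    refine monotone_nat_of_le_succ fun n => ?_
    cases n with
    | zero => exact zero_le
    | succ n =>
      have := hs (Nat.le_succ n)
      simp only [hτ]
      gcongr
  have hind := hX.indepIncrements.nat hτm
  have hmeas : ∀ j, Measurable fun ω => X (τ (j + 1)) ω - X (τ j) ω := fun j =>
    (hX.measurable _).sub (hX.measurable _)
  have hproc : IndepFun (fun ω => X (τ 1) ω - X (τ 0) ω)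
      (fun ω j => X (τ (j + 2)) ω - X (τ (j + 1)) ω) P := by
    refine IndepFun.indepFun_process (hmeas 0) (fun j => hmeas (j + 1)) fun J => ?_
    have := hind.indepFun_finset {0} (J.map ⟨(· + 1), add_left_injective 1⟩) (by simp) hmeas
    have hφ : Measurable fun y : ({0} : Finset ℕ) → ℕ => y ⟨0, Finset.mem_singleton_self 0⟩ :=
      measurable_pi_apply _
    have hψ : Measurable fun (y : J.map ⟨(· + 1), add_left_injective 1⟩ → ℕ) (i : J) =>
        y ⟨i + 1, Finset.mem_map_of_mem ⟨(· + 1), add_left_injective 1⟩ i.2⟩ :=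
      measurable_pi_lambda _ fun i => measurable_pi_apply _
    exact this.comp hφ hψ
  refine (hproc.comp (φ := id) (ψ := fun y (i : I) => ∑ j ∈ Finset.range (k i), y j)
    measurable_id (measurable_pi_lambda _ fun i =>
      Finset.measurable_sum _ fun j _ => measurable_pi_apply j)).congr ?_ ?_
  · filter_upwards [hX.zero] with ω hω
    simp [hτ, hs0, hω]
  · filter_upwards [hX.shiftedBy_eq_sum h hs hs0] with ω hω
    funext i
    have := hω (k i)
    rw [hk] at this
    exact this.symm

/-- The Markov property of a pair of independent Poisson processes at a fixed time. -/
lemma IsPoissonProcess.measure_inter_shiftedBy [IsProbabilityMeasure P]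
    (hX : IsPoissonProcess X r P) {Y : ℝ≥0 → Ω → ℕ} {q : ℝ≥0} (hY : IsPoissonProcess Y q P)
    (hXY : IndepFun (fun ω s => X s ω) (fun ω s => Y s ω) P) (h : ℝ≥0) (n d : ℕ)
    {A : Set ((ℝ≥0 → ℕ) × (ℝ≥0 → ℕ))} (hA : MeasurableSet A) :
    P ({ω | (fun s => shiftedBy X h s ω, fun s => shiftedBy Y h s ω) ∈ A} ∩
        {ω | X h ω = n ∧ Y h ω = d}) =
      P {ω | X h ω = n} * P {ω | Y h ω = d} * P {ω | (fun s => X s ω, fun s => Y s ω) ∈ A} := by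
  have mX : Measurable fun ω s => X s ω := measurable_pi_lambda _ hX.measurable
  have mY : Measurable fun ω s => Y s ω := measurable_pi_lambda _ hY.measurable
  have mX' : Measurable fun ω s => shiftedBy X h s ω :=
    measurable_pi_lambda _ (hX.measurable_shiftedBy h)
  have mY' : Measurable fun ω s => shiftedBy Y h s ω :=
    measurable_pi_lambda _ (hY.measurable_shiftedBy h)
  have key : (P.restrict {ω | X h ω = n ∧ Y h ω = d}).map
        (fun ω => (fun s => shiftedBy X h s ω, fun s => shiftedBy Y h s ω)) =
      (P {ω | X h ω = n} * P {ω | Y h ω = d}) •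
        P.map (fun ω => (fun s => X s ω, fun s => Y s ω)) := by
    have : IsFiniteMeasure ((P {ω | X h ω = n} * P {ω | Y h ω = d}) •
        P.map (fun ω => (fun s => X s ω, fun s => Y s ω))) :=
      Measure.smul_finite _ (ENNReal.mul_ne_top (measure_ne_top _ _) (measure_ne_top _ _))
    -- Finite measures on a product are determined by rectangles, where the probability factors by
    -- independence of `X` and `Y` and the Markov property of each.
    refine Measure.ext_prod fun {S T} hS hT => ?_
    rw [Measure.map_apply (mX'.prodMk mY') (hS.prod hT),
      Measure.restrict_apply ((mX'.prodMk mY') (hS.prod hT)), Measure.smul_apply,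
      Measure.map_apply (mX.prodMk mY) (hS.prod hT)]
    have hshift : Measurable fun (y : ℝ≥0 → ℕ) => (y h, fun s => y (h + s) - y h) :=
      (measurable_pi_apply h).prodMk (measurable_pi_lambda _ fun s =>
        (measurable_pi_apply _).sub (measurable_pi_apply _))
    have i1 := (hXY.comp hshift hshift).measure_inter_preimage_eq_mul ({n} ×ˢ S) ({d} ×ˢ T)
      ((measurableSet_singleton n).prod hS) ((measurableSet_singleton d).prod hT)
    have i2 := (hX.indepFun_shiftedBy h).measure_inter_preimage_eq_mul {n} S
      (measurableSet_singleton n) hS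
    have i3 := (hY.indepFun_shiftedBy h).measure_inter_preimage_eq_mul {d} T
      (measurableSet_singleton d) hT
    have i4 := hXY.measure_inter_preimage_eq_mul S T hS hT
    have l1 := congrArg (fun μ => μ S) (hX.map_shiftedBy h)
    have l2 := congrArg (fun μ => μ T) (hY.map_shiftedBy h)
    simp only [Measure.map_apply mX' hS, Measure.map_apply mX hS] at l1
    simp only [Measure.map_apply mY' hT, Measure.map_apply mY hT] at l2
    have e1 : ((fun ω => (fun s => shiftedBy X h s ω, fun s => shiftedBy Y h s ω)) ⁻¹' S ×ˢ T) ∩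
        {ω | X h ω = n ∧ Y h ω = d} =
        (X h ⁻¹' {n} ∩ (fun ω s => shiftedBy X h s ω) ⁻¹' S) ∩
          (Y h ⁻¹' {d} ∩ (fun ω s => shiftedBy Y h s ω) ⁻¹' T) := by
      ext ω; simp; tauto
    have e2 : (fun ω => (fun s => X s ω, fun s => Y s ω)) ⁻¹' S ×ˢ T =
        (fun ω s => X s ω) ⁻¹' S ∩ (fun ω s => Y s ω) ⁻¹' T := rfl
    rw [e1, e2]
    refine i1.trans ?_
    refine (congrArg₂ (· * ·) i2 i3).trans ?_
    rw [l1, l2, i4, smul_eq_mul]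
    change P {ω | X h ω = n} * _ * (P {ω | Y h ω = d} * _) = _
    ring
  have := congrArg (fun μ => μ A) key
  simp only [Measure.map_apply (mX'.prodMk mY') hA, Measure.smul_apply,
    Measure.map_apply (mX.prodMk mY) hA, Measure.restrict_apply ((mX'.prodMk mY') hA)] at this
  exact this

end PoissonProcess

/-! ### Ruin along counting paths -/

section Paths

variable {b w : ℕ} {u : ℝ} {s : ℝ≥0}

/-- A counting path: it starts at `0`, is non-decreasing and right-continuous. -/
structure IsCountingPath (n : ℝ≥0 → ℕ) : Prop where
  zero : n 0 = 0
  mono : Monotone n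
  rightCts : ∀ s, ContinuousWithinAt n (Set.Ici s) s

lemma IsCountingPath.shift {n : ℝ≥0 → ℕ} (hn : IsCountingPath n) (h : ℝ≥0) :
    IsCountingPath fun s => n (h + s) - n h where
  zero := by simp
  mono := fun s v hsv => Nat.sub_le_sub_right (hn.mono (by gcongr)) _
  rightCts := fun s => by
    have h1 : ContinuousWithinAt (fun v => n (h + v)) (Set.Ici s) s :=
      (hn.rightCts (h + s)).comp (f := fun v => h + v) (by fun_prop) fun v hv => by
        simpa using hv
    exact (continuous_of_discreteTopology (f := fun k : ℕ => k - n h)).continuousAt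
      |>.comp_continuousWithinAt h1

/-- Counting paths are locally constant from the right. -/
lemma IsCountingPath.exists_eq {n : ℝ≥0 → ℕ} (hn : IsCountingPath n) (s : ℝ≥0) :
    ∃ v > s, ∀ x ∈ Set.Ico s v, n x = n s := by
  have h := hn.rightCts s
  rw [ContinuousWithinAt, nhds_discrete, Filter.tendsto_pure] at h
  obtain ⟨v, hv, hsub⟩ := (mem_nhdsGE_iff_exists_Ico_subset).1 h
  exact ⟨v, hv, fun x hx => hsub hx⟩

/-- The surplus along a pair of paths, the first one for blocks and the second one for the other
shares. -/
noncomputable def pathSurplus (b w : ℕ) (u : ℝ) (p : (ℝ≥0 → ℕ) × (ℝ≥0 → ℕ)) (s : ℝ≥0) : ℝ :=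
  u - ((p.2 s + p.1 s : ℕ) : ℝ) * w + (p.1 s : ℝ) * b

/-- The paths that are ruined at some time up to `s`. -/
def ruinedBy (b w : ℕ) (u : ℝ) (s : ℝ≥0) : Set ((ℝ≥0 → ℕ) × (ℝ≥0 → ℕ)) :=
  {p | ∃ v ≤ s, pathSurplus b w u p v < 0}

/-- The paths that are ruined at some time in a countable dense set of times up to `s`. -/
def ruinedByCountable (b w : ℕ) (u : ℝ) (s : ℝ≥0) : Set ((ℝ≥0 → ℕ) × (ℝ≥0 → ℕ)) :=
  {p | pathSurplus b w u p s < 0 ∨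
    ∃ k : ℕ, TopologicalSpace.denseSeq ℝ≥0 k ≤ s ∧
      pathSurplus b w u p (TopologicalSpace.denseSeq ℝ≥0 k) < 0}

lemma measurable_pathSurplus (s : ℝ≥0) : Measurable fun p => pathSurplus b w u p s := by
  have h1 : Measurable fun p : (ℝ≥0 → ℕ) × (ℝ≥0 → ℕ) => p.1 s :=
    (measurable_pi_apply s).comp measurable_fst
  have h2 : Measurable fun p : (ℝ≥0 → ℕ) × (ℝ≥0 → ℕ) => p.2 s :=
    (measurable_pi_apply s).comp measurable_snd
  have h3 : Measurable (Nat.cast : ℕ → ℝ) := Measurable.of_discrete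
  exact (measurable_const.sub ((h3.comp (h2.add h1)).mul_const _)).add ((h3.comp h1).mul_const _)

lemma measurableSet_ruinedByCountable : MeasurableSet (ruinedByCountable b w u s) := by
  have : ruinedByCountable b w u s = {p | pathSurplus b w u p s < 0} ∪
      ⋃ k : ℕ, {p | TopologicalSpace.denseSeq ℝ≥0 k ≤ s ∧
        pathSurplus b w u p (TopologicalSpace.denseSeq ℝ≥0 k) < 0} := by
    ext p; simp [ruinedByCountable]
  rw [this]
  refine (measurableSet_lt (measurable_pathSurplus _) measurable_const).union
    (MeasurableSet.iUnion fun k => ?_)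
  exact (MeasurableSet.const _).inter (measurableSet_lt (measurable_pathSurplus _) measurable_const)

lemma exists_pathSurplus_eq {p : (ℝ≥0 → ℕ) × (ℝ≥0 → ℕ)} (h1 : IsCountingPath p.1)
    (h2 : IsCountingPath p.2) (s : ℝ≥0) :
    ∃ v > s, ∀ x ∈ Set.Ico s v, pathSurplus b w u p x = pathSurplus b w u p s := by
  obtain ⟨v1, hv1, e1⟩ := h1.exists_eq s
  obtain ⟨v2, hv2, e2⟩ := h2.exists_eq s
  refine ⟨min v1 v2, lt_min hv1 hv2, fun x hx => ?_⟩
  rw [pathSurplus, pathSurplus, e1 x ⟨hx.1, hx.2.trans_le (min_le_left _ _)⟩,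
    e2 x ⟨hx.1, hx.2.trans_le (min_le_right _ _)⟩]

/-- `ruinedBy` quantifies over uncountably many times, while equality of laws on path space applies
to measurable sets. Right-continuity lets a dense sequence of times suffice. -/
lemma mem_ruinedBy_iff_countable {p : (ℝ≥0 → ℕ) × (ℝ≥0 → ℕ)} (h1 : IsCountingPath p.1)
    (h2 : IsCountingPath p.2) : p ∈ ruinedBy b w u s ↔ p ∈ ruinedByCountable b w u s := by
  constructor
  · rintro ⟨v, hv, hneg⟩
    -- The endpoint needs its own clause: the interval of constancy to its right lies beyond the
    -- horizon.
    rcases hv.eq_or_lt with rfl | hlt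
    · exact Or.inl hneg
    · obtain ⟨v', hv', he⟩ := exists_pathSurplus_eq (b := b) (w := w) (u := u) h1 h2 v
      obtain ⟨q, ⟨k, rfl⟩, hq1, hq2⟩ :=
        (TopologicalSpace.denseRange_denseSeq ℝ≥0).exists_between (lt_min hlt hv')
      exact Or.inr ⟨k, hq2.le.trans (min_le_left _ _),
        by rw [he _ ⟨hq1.le, hq2.trans_le (min_le_right _ _)⟩]; exact hneg⟩
  · rintro (hneg | ⟨k, hk, hneg⟩)
    · exact ⟨s, le_rfl, hneg⟩
    · exact ⟨_, hk, hneg⟩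

/-- Ruin by the time `h + s` of a path with at most one jump up to the time `h`. -/
lemma mem_ruinedBy_add_iff {p : (ℝ≥0 → ℕ) × (ℝ≥0 → ℕ)} (h1 : IsCountingPath p.1)
    (h2 : IsCountingPath p.2) (hu : 0 ≤ u) (hbw : w ≤ b) {h : ℝ≥0} {n d : ℕ} (hnd : n + d ≤ 1)
    (hn : p.1 h = n) (hd : p.2 h = d) :
    p ∈ ruinedBy b w u (h + s) ↔
      (fun v => p.1 (h + v) - p.1 h, fun v => p.2 (h + v) - p.2 h) ∈
        ruinedBy b w (u + n * b - (n + d) * w) s := by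
  have hbwR : (w : ℝ) ≤ b := by exact_mod_cast hbw
  have hshift : ∀ v, pathSurplus b w u p (h + v) =
      pathSurplus b w (u + n * b - (n + d) * w)
        (fun v => p.1 (h + v) - p.1 h, fun v => p.2 (h + v) - p.2 h) v := by
    intro v
    have l1 : n ≤ p.1 (h + v) := hn ▸ h1.mono le_self_add
    have l2 : d ≤ p.2 (h + v) := hd ▸ h2.mono le_self_add
    simp only [pathSurplus, hn, hd]
    push_cast [Nat.cast_sub l1, Nat.cast_sub l2]
    ring
  constructor
  · rintro ⟨v, hv, hneg⟩
    rcases le_or_gt h v with hle | hlt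
    · obtain ⟨v', rfl⟩ := exists_add_of_le hle
      exact ⟨v', by simpa using hv, hshift v' ▸ hneg⟩
    · refine ⟨0, zero_le, ?_⟩
      rw [← hshift, add_zero]
      have m1 : p.1 v ≤ n := hn ▸ h1.mono hlt.le
      have m2 : p.2 v ≤ d := hd ▸ h2.mono hlt.le
      -- Blocks alone do not lower the surplus, so ruin before `h` requires the single allowed jump
      -- to be a non-block share. No jump then remains in `(v, h]`, and the surplus is still
      -- negative at `h`.
      have hd1 : p.2 v ≠ 0 := by
        intro h0
        simp only [pathSurplus, h0, zero_add] at hneg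
        have : (0 : ℝ) ≤ p.1 v * (b - w) := mul_nonneg (Nat.cast_nonneg _) (by linarith)
        linarith
      have e1 : p.1 h = p.1 v := by omega
      have e2 : p.2 h = p.2 v := by omega
      simpa only [pathSurplus, e1, e2] using hneg
  · rintro ⟨v, hv, hneg⟩
    exact ⟨h + v, by gcongr, hshift v ▸ hneg⟩

/-- The time of ruin is attained. -/
lemma ruinTime_le_iff {Ω : Type*} {N D : ℝ≥0 → Ω → ℕ} {s : ℝ} {ω : Ω} (h1 : IsCountingPath fun v => N v ω)
    (h2 : IsCountingPath fun v => D v ω) :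
    ruinTime b w N D u ω ≤ ENNReal.ofReal s ↔
      (fun v => N v ω, fun v => D v ω) ∈ ruinedBy b w u s.toNNReal := by
  constructor
  · intro hle
    by_contra hnot
    have hpos : ∀ v ≤ s.toNNReal, ¬ surplus b w N D u v ω < 0 := fun v hv hneg =>
      hnot ⟨v, hv, hneg⟩
    -- Without ruin up to `s`, the surplus stays nonnegative until some `v > s`, so the infimum
    -- exceeds `s`.
    obtain ⟨v, hv, he⟩ := exists_pathSurplus_eq (b := b) (w := w) (u := u)
      (p := (fun v => N v ω, fun v => D v ω)) h1 h2 s.toNNReal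
    have hge : (v : ℝ≥0∞) ≤ ruinTime b w N D u ω := by
      refine le_sInf ?_
      rintro _ ⟨x, rfl, hx⟩
      rw [ENNReal.coe_le_coe]
      by_contra! hxv
      rcases le_total x s.toNNReal with hxs | hxs
      · exact hpos x hxs hx
      · refine hpos _ le_rfl ?_
        have := he x ⟨hxs, hxv⟩
        simp only [pathSurplus] at this
        simp only [surplus] at hx ⊢
        rwa [← this]
    have : (v : ℝ≥0∞) ≤ (s.toNNReal : ℝ≥0∞) := hge.trans hle
    exact absurd (ENNReal.coe_le_coe.1 this) (not_le.2 hv)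
  · rintro ⟨v, hv, hneg⟩
    have hmem : ∃ x : ℝ≥0, (v : ℝ≥0∞) = x ∧ surplus b w N D u x ω < 0 := ⟨v, rfl, hneg⟩
    refine (sInf_le (α := ℝ≥0∞) hmem).trans ?_
    exact ENNReal.coe_le_coe.2 hv

end Paths

/-! ### First-step analysis over a short time -/

section RuinProbability

variable {Ω : Type*} [MeasurableSpace Ω] {P : Measure Ω} {N D : ℝ≥0 → Ω → ℕ} {l m : ℝ≥0}
  {b w : ℕ}

lemma IsPoissonProcess.ae_isCountingPath {X : ℝ≥0 → Ω → ℕ} {r : ℝ≥0}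
    (hX : IsPoissonProcess X r P) : ∀ᵐ ω ∂P, IsCountingPath fun s => X s ω := by
  filter_upwards [hX.zero, hX.mono, hX.rightCts] with ω h1 h2 h3 using ⟨h1, h2, h3⟩

/-- The probability of ruin up to `s`, in terms of paths. -/
noncomputable def pathRuinProb (P : Measure Ω) (b w : ℕ) (N D : ℝ≥0 → Ω → ℕ) (u : ℝ) (s : ℝ≥0) :
    ℝ :=
  P.real {ω | (fun v => N v ω, fun v => D v ω) ∈ ruinedBy b w u s}

lemma ruinProb_eq (hN : IsPoissonProcess N l P) (hD : IsPoissonProcess D m P) (u s : ℝ) :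
    ruinProb P b w N D u s = pathRuinProb P b w N D u s.toNNReal := by
  refine measureReal_congr ?_
  filter_upwards [hN.ae_isCountingPath, hD.ae_isCountingPath] with ω h1 h2
  exact propext (ruinTime_le_iff h1 h2)

lemma pathRuinProb_mono [IsProbabilityMeasure P] (u : ℝ) : Monotone (pathRuinProb P b w N D u) :=
  fun _ _ hsv => by
    refine measureReal_mono ?_
    rintro ω ⟨v, hv, hneg⟩
    exact ⟨v, hv.trans hsv, hneg⟩

lemma pathRuinProb_of_neg [IsProbabilityMeasure P] (hN : IsPoissonProcess N l P)
    (hD : IsPoissonProcess D m P) {u : ℝ} (hu : u < 0) (s : ℝ≥0) :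
    pathRuinProb P b w N D u s = 1 := by
  have : {ω | (fun v => N v ω, fun v => D v ω) ∈ ruinedBy b w u s} =ᵐ[P] Set.univ := by
    filter_upwards [hN.zero, hD.zero] with ω h1 h2
    refine eq_true ?_
    exact ⟨0, zero_le, by simpa [pathSurplus, h1, h2] using hu⟩
  rw [pathRuinProb, measureReal_congr this]
  simp

lemma IsPoissonProcess.measureReal_eq {X : ℝ≥0 → Ω → ℕ} {r : ℝ≥0}
    (hX : IsPoissonProcess X r P) (h : ℝ≥0) (n : ℕ) :
    P.real {ω | X h ω = n} =
      Real.exp (-(r * h : ℝ)) * (r * h : ℝ) ^ n / (n.factorial : ℝ) := by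
  have h1 := (hX.law 0 h zero_le).measureReal_eq (p := fun k => k = n) (measurableSet_singleton n)
  have h2 : {ω | X h ω = n} =ᵐ[P] {ω | X h ω - X 0 ω = n} := by
    filter_upwards [hX.zero] with ω hω
    refine propext ?_
    change X h ω = n ↔ X h ω - X 0 ω = n
    rw [hω, Nat.sub_zero]
  rw [measureReal_congr h2, h1, Set.ofPred_eq_eq_singleton, poissonMeasure_real_singleton]
  simp

lemma IsPoissonProcess.measureReal_ne_zero_le [IsProbabilityMeasure P] {X : ℝ≥0 → Ω → ℕ}
    {r : ℝ≥0} (hX : IsPoissonProcess X r P) (h : ℝ≥0) : P.real {ω | X h ω ≠ 0} ≤ r * h := by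
  have h1 : {ω | X h ω ≠ 0} = {ω | X h ω = 0}ᶜ := rfl
  have h2 : MeasurableSet {ω | X h ω = 0} := hX.measurable h (measurableSet_singleton 0)
  rw [h1, probReal_compl_eq_one_sub h2,
    hX.measureReal_eq]
  have := Real.add_one_le_exp (-(r * h : ℝ))
  simp
  linarith

/-- Ruin from `u ≥ 0` requires a jump. This linear bound makes the contribution of horizons shorter
than `h` of order `h^2` later on. -/
lemma pathRuinProb_le [IsProbabilityMeasure P] (hN : IsPoissonProcess N l P)
    (hD : IsPoissonProcess D m P) {u : ℝ} (hu : 0 ≤ u) (s : ℝ≥0) :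
    pathRuinProb P b w N D u s ≤ (l + m) * s := by
  have hsub : {ω | (fun v => N v ω, fun v => D v ω) ∈ ruinedBy b w u s} ≤ᵐ[P]
      ({ω | N s ω ≠ 0} ∪ {ω | D s ω ≠ 0} : Set Ω) := by
    filter_upwards [hN.mono, hD.mono] with ω h1 h2 ⟨v, hv, hneg⟩
    by_contra hnot
    have hnot' : N s ω = 0 ∧ D s ω = 0 := by
      refine ⟨?_, ?_⟩
      · by_contra h0
        exact hnot (Or.inl h0)
      · by_contra h0
        exact hnot (Or.inr h0)
    have e1 : N v ω = 0 := Nat.le_zero.1 (hnot'.1 ▸ h1 hv)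
    have e2 : D v ω = 0 := Nat.le_zero.1 (hnot'.2 ▸ h2 hv)
    simp only [pathSurplus, e1, e2] at hneg
    norm_num at hneg
    linarith
  calc pathRuinProb P b w N D u s ≤ P.real ({ω | N s ω ≠ 0} ∪ {ω | D s ω ≠ 0}) :=
        ENNReal.toReal_mono (measure_ne_top _ _) (measure_mono_ae hsub)
    _ ≤ P.real {ω | N s ω ≠ 0} + P.real {ω | D s ω ≠ 0} := measureReal_union_le _ _
    _ ≤ l * s + m * s := add_le_add (hN.measureReal_ne_zero_le s) (hD.measureReal_ne_zero_le s)
    _ = _ := by ring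

lemma measureReal_ruinedBy_inter [IsProbabilityMeasure P] (hN : IsPoissonProcess N l P)
    (hD : IsPoissonProcess D m P) (hND : IndepFun (fun ω s => N s ω) (fun ω s => D s ω) P)
    (hbw : w ≤ b) {u : ℝ} (hu : 0 ≤ u) (h s : ℝ≥0) {n d : ℕ} (hnd : n + d ≤ 1) :
    P.real ({ω | (fun v => N v ω, fun v => D v ω) ∈ ruinedBy b w u (h + s)} ∩
        {ω | N h ω = n ∧ D h ω = d}) =
      P.real {ω | N h ω = n} * P.real {ω | D h ω = d} *
        pathRuinProb P b w N D (u + n * b - (n + d) * w) s := by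
  have e1 : ({ω | (fun v => N v ω, fun v => D v ω) ∈ ruinedBy b w u (h + s)} ∩
        {ω | N h ω = n ∧ D h ω = d} : Set Ω) =ᵐ[P]
      ({ω | (fun v => shiftedBy N h v ω, fun v => shiftedBy D h v ω) ∈
        ruinedByCountable b w (u + n * b - (n + d) * w) s} ∩ {ω | N h ω = n ∧ D h ω = d} :
          Set Ω) := by
    filter_upwards [hN.ae_isCountingPath, hD.ae_isCountingPath] with ω h1 h2
    refine propext (and_congr_left fun hω => ?_)
    refine (mem_ruinedBy_add_iff (p := (fun v => N v ω, fun v => D v ω)) h1 h2 hu hbw hnd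
      hω.1 hω.2).trans ?_
    exact mem_ruinedBy_iff_countable (p := (fun v => N (h + v) ω - N h ω,
      fun v => D (h + v) ω - D h ω)) (h1.shift h) (h2.shift h)
  have e2 : {ω | (fun v => N v ω, fun v => D v ω) ∈
        ruinedBy b w (u + n * b - (n + d) * w) s} =ᵐ[P]
      {ω | (fun v => N v ω, fun v => D v ω) ∈
        ruinedByCountable b w (u + n * b - (n + d) * w) s} := by
    filter_upwards [hN.ae_isCountingPath, hD.ae_isCountingPath] with ω h1 h2
    exact propext (mem_ruinedBy_iff_countable (p := (fun v => N v ω, fun v => D v ω)) h1 h2)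
  rw [pathRuinProb, measureReal_congr e1, measureReal_congr e2]
  simp only [measureReal_def]
  rw [hN.measure_inter_shiftedBy hD hND h n d measurableSet_ruinedByCountable,
    ENNReal.toReal_mul, ENNReal.toReal_mul]

/-- The error made by keeping only three disjoint parts of an event. -/
lemma abs_measureReal_sub_inter_le [IsProbabilityMeasure P] (E : Set Ω) {A B C : Set Ω}
    (hA : MeasurableSet A) (hB : MeasurableSet B) (hC : MeasurableSet C) (hAB : Disjoint A B)
    (hAC : Disjoint A C) (hBC : Disjoint B C) :
    |P.real E - (P.real (E ∩ A) + P.real (E ∩ B) + P.real (E ∩ C))| ≤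
      1 - (P.real A + P.real B + P.real C) := by
  have key : ∀ E : Set Ω, P.real E - (P.real (E ∩ A) + P.real (E ∩ B) + P.real (E ∩ C)) =
      P.real (((E \ A) \ B) \ C) := by
    intro E
    have a1 := measureReal_inter_add_sdiff (μ := P) (s := E) hA
    have a2 := measureReal_inter_add_sdiff (μ := P) (s := E \ A) hB
    have a3 := measureReal_inter_add_sdiff (μ := P) (s := (E \ A) \ B) hC
    have b2 : (E \ A) ∩ B = E ∩ B := by
      ext ω
      have : _ → ω ∉ _ := fun h => Set.disjoint_left.1 hAB h
      grind
    have b3 : ((E \ A) \ B) ∩ C = E ∩ C := by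
      ext ω
      have : _ → ω ∉ _ := fun h => Set.disjoint_left.1 hAC h
      have : _ → ω ∉ _ := fun h => Set.disjoint_left.1 hBC h
      grind
    rw [b2] at a2
    rw [b3] at a3
    linarith
  -- The error is the mass of `E` outside the three parts, at most that of the whole space outside
  -- them.
  have ku := key Set.univ
  simp only [Set.univ_inter, probReal_univ] at ku
  rw [key E, ku, abs_of_nonneg measureReal_nonneg]
  exact measureReal_mono (by gcongr; exact Set.subset_univ E)

/-- The first-step analysis over a short time `h`. -/
lemma abs_pathRuinProb_add_sub_le [IsProbabilityMeasure P] (hN : IsPoissonProcess N l P)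
    (hD : IsPoissonProcess D m P) (hND : IndepFun (fun ω s => N s ω) (fun ω s => D s ω) P)
    (hbw : w ≤ b) {u : ℝ} (hu : 0 ≤ u) (h s : ℝ≥0) :
    |pathRuinProb P b w N D u (h + s) - Real.exp (-((l + m) * h : ℝ)) *
      (pathRuinProb P b w N D u s + l * h * pathRuinProb P b w N D (u + b - w) s +
        m * h * pathRuinProb P b w N D (u - w) s)| ≤ ((l + m) * h : ℝ) ^ 2 := by
  have hmeas : ∀ n d : ℕ, MeasurableSet {ω | N h ω = n ∧ D h ω = d} := fun n d =>
    (hN.measurable h (measurableSet_singleton n)).inter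
      (hD.measurable h (measurableSet_singleton d))
  have hdisj : ∀ n d n' d' : ℕ, n ≠ n' ∨ d ≠ d' →
      Disjoint {ω | N h ω = n ∧ D h ω = d} {ω | N h ω = n' ∧ D h ω = d'} := by
    intro n d n' d' hne
    refine Set.disjoint_left.2 fun ω h1 h2 => ?_
    simp only [Set.mem_ofPred_eq] at h1 h2
    omega
  have hprod : ∀ n d : ℕ, P.real {ω | N h ω = n ∧ D h ω = d} =
      P.real {ω | N h ω = n} * P.real {ω | D h ω = d} := by
    intro n d
    have hp : Measurable fun y : ℝ≥0 → ℕ => y h := measurable_pi_apply h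
    have := (hND.comp hp hp).measure_inter_preimage_eq_mul {n} {d}
      (measurableSet_singleton n) (measurableSet_singleton d)
    simp only [measureReal_def]
    rw [← ENNReal.toReal_mul]
    exact congrArg ENNReal.toReal this
  have hE := abs_measureReal_sub_inter_le (P := P)
    {ω | (fun v => N v ω, fun v => D v ω) ∈ ruinedBy b w u (h + s)}
    (hmeas 0 0) (hmeas 1 0) (hmeas 0 1) (hdisj _ _ _ _ (by simp)) (hdisj _ _ _ _ (by simp))
    (hdisj _ _ _ _ (by simp))
  rw [measureReal_ruinedBy_inter hN hD hND hbw hu h s (by norm_num),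
    measureReal_ruinedBy_inter hN hD hND hbw hu h s (by norm_num),
    measureReal_ruinedBy_inter hN hD hND hbw hu h s (by norm_num), hprod, hprod, hprod,
    hN.measureReal_eq, hN.measureReal_eq, hD.measureReal_eq, hD.measureReal_eq] at hE
  have hexp : Real.exp (-((l + m) * h : ℝ)) = Real.exp (-(l * h : ℝ)) * Real.exp (-(m * h : ℝ)) := by
    rw [← Real.exp_add]; congr 1; ring
  have hbound : 1 - Real.exp (-((l + m) * h : ℝ)) * (1 + (l + m) * h) ≤ ((l + m) * h : ℝ) ^ 2 := by
    have h1 := Real.add_one_le_exp (-((l + m) * h : ℝ))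
    have h2 : (0 : ℝ) ≤ (l + m) * h := by positivity
    -- With `x = (l + m) h`, `exp(-x) ≥ 1 - x` bounds the left-hand side by `1 - (1 - x)(1 + x) =
    -- x^2`.
    nlinarith
  refine le_trans (le_of_eq_of_le ?_ hE) (le_of_eq_of_le ?_ hbound)
  · rw [hexp]
    have a0 : u + ((0 : ℕ) : ℝ) * b - (((0 : ℕ) : ℝ) + ((0 : ℕ) : ℝ)) * w = u := by simp
    have a1 : u + ((1 : ℕ) : ℝ) * b - (((1 : ℕ) : ℝ) + ((0 : ℕ) : ℝ)) * w = u + b - w := by simp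
    have a2 : u + ((0 : ℕ) : ℝ) * b - (((0 : ℕ) : ℝ) + ((1 : ℕ) : ℝ)) * w = u - w := by simp
    rw [a0, a1, a2]
    congr 1
    simp only [Nat.factorial_zero, Nat.factorial_one, pow_zero, pow_one, Nat.cast_one, mul_one,
      div_one]
    rw [← pathRuinProb]
    ring
  · rw [hexp]
    simp only [Nat.factorial_zero, Nat.factorial_one, pow_zero, pow_one, Nat.cast_one, mul_one,
      div_one]
    ring

end RuinProbability

/-! ### Averaging over an exponential horizon -/

section ExponentialHorizon

variable {a : ℝ}

lemma ae_nonneg_expMeasure : ∀ᵐ s ∂expMeasure a, 0 ≤ s := by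
  have hm : Measurable (gammaPDF 1 a) := (measurable_gammaPDFReal 1 a).ennreal_ofReal
  rw [expMeasure, gammaMeasure, ae_withDensity_iff hm]
  refine Filter.Eventually.of_forall fun x hx => ?_
  by_contra! h
  exact hx (gammaPDF_of_neg h)

lemma integral_expMeasure_eq (ha : 0 < a) (g : ℝ → ℝ) :
    ∫ s, g s ∂expMeasure a = ∫ s, exponentialPDFReal a s * g s := by
  have h : expMeasure a = volume.withDensity fun x => ENNReal.ofReal (exponentialPDFReal a x) := rfl
  rw [h, integral_withDensity_eq_integral_toReal_smul
    (measurable_exponentialPDFReal a).ennreal_ofReal (by simp)]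
  refine integral_congr_ae (Filter.Eventually.of_forall fun s => ?_)
  simp only [smul_eq_mul]
  rw [ENNReal.toReal_ofReal (exponentialPDFReal_nonneg ha s)]

lemma exponentialPDFReal_eq (x : ℝ) :
    exponentialPDFReal a x = if 0 ≤ x then a * Real.exp (-(a * x)) else 0 := by
  simp [exponentialPDFReal, gammaPDFReal]

/-- The memoryless property of the exponential distribution. -/
lemma integral_comp_add_expMeasure (ha : 0 < a) {h : ℝ} (hh : 0 ≤ h) (g : ℝ → ℝ) :
    ∫ s, g (s + h) ∂expMeasure a =
      Real.exp (a * h) * ∫ s, (Set.Ici h).indicator g s ∂expMeasure a := by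
  rw [integral_expMeasure_eq ha, integral_expMeasure_eq ha, ← integral_const_mul,
    ← integral_sub_right_eq_self _ h]
  refine integral_congr_ae (Filter.Eventually.of_forall fun y => ?_)
  simp only [sub_add_cancel, exponentialPDFReal_eq, Set.indicator_apply, Set.mem_Ici, sub_nonneg]
  by_cases hy : h ≤ y
  · simp only [hy, hh.trans hy, if_true]
    have he : Real.exp (-(a * (y - h))) = Real.exp (a * h) * Real.exp (-(a * y)) := by
      rw [← Real.exp_add]; congr 1; ring
    rw [he]
    ring
  · simp [hy]

lemma measureReal_Iio_expMeasure_le (ha : 0 < a) {h : ℝ} (hh : 0 ≤ h) :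
    (expMeasure a).real (Set.Iio h) ≤ a * h := by
  have := isProbabilityMeasure_expMeasure ha
  calc (expMeasure a).real (Set.Iio h) ≤ (expMeasure a).real (Set.Iic h) :=
        measureReal_mono Set.Iio_subset_Iic_self
    _ = 1 - Real.exp (-(a * h)) := by
        rw [← cdf_eq_real, cdf_expMeasure_eq ha, if_pos hh]
    _ ≤ a * h := by
        have := Real.add_one_le_exp (-(a * h))
        linarith

/-- From the infinitesimal behaviour of functions of the time horizon to an equation for their
means over an exponential horizon. -/
lemma integral_expMeasure_of_infinitesimal (ha : 0 < a) {g g₁ g₂ : ℝ≥0 → ℝ} {k l m : ℝ}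
    (hg : Monotone g) (hg₁ : Monotone g₁) (hg₂ : Monotone g₂)
    (b : ∀ s, |g s| ≤ 1) (b₁ : ∀ s, |g₁ s| ≤ 1) (b₂ : ∀ s, |g₂ s| ≤ 1) (hk : 0 ≤ k)
    (hsmall : ∀ s, |g s| ≤ k * s)
    (hstep : ∀ h s : ℝ≥0, |g (h + s) - Real.exp (-(k * h)) *
      (g s + l * h * g₁ s + m * h * g₂ s)| ≤ (k * h) ^ 2) :
    (k + a) * ∫ s, g s.toNNReal ∂expMeasure a =
      l * ∫ s, g₁ s.toNNReal ∂expMeasure a + m * ∫ s, g₂ s.toNNReal ∂expMeasure a := by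
  have := isProbabilityMeasure_expMeasure ha
  have hint : ∀ {f : ℝ≥0 → ℝ}, Monotone f → (∀ s, |f s| ≤ 1) →
      Integrable (fun s : ℝ => f s.toNNReal) (expMeasure a) := fun {f} hf hb =>
    Integrable.of_bound (hf.measurable.comp measurable_real_toNNReal).aestronglyMeasurable 1
      (Filter.Eventually.of_forall fun s => hb _)
  have i0 := hint hg b
  have i1 := hint hg₁ b₁
  have i2 := hint hg₂ b₂
  set F := ∫ s, g s.toNNReal ∂expMeasure a with hF
  set F₁ := ∫ s, g₁ s.toNNReal ∂expMeasure a with hF₁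
  set F₂ := ∫ s, g₂ s.toNNReal ∂expMeasure a with hF₂
  -- Both terms approximate the mean of `g (T + h)`: the first by memorylessness, up to horizons
  -- below `h`, where `g ≤ k h` on mass at most `a h`; the second by `hstep`.
  have hmain : ∀ h : ℝ, 0 ≤ h → |Real.exp (a * h) * F - Real.exp (-(k * h)) *
      (F + l * h * F₁ + m * h * F₂)| ≤ Real.exp (a * h) * (k * a * h ^ 2) + (k * h) ^ 2 := by
    intro h hh
    set G : ℝ → ℝ := fun s => g s.toNNReal with hG
    have hshift := integral_comp_add_expMeasure ha hh G
    have iA : Integrable ((Set.Ici h).indicator G) (expMeasure a) := i0.indicator measurableSet_Ici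
    have iB : Integrable ((Set.Iio h).indicator G) (expMeasure a) := i0.indicator measurableSet_Iio
    have hsplit : F = ∫ s, (Set.Ici h).indicator G s ∂expMeasure a +
        ∫ s, (Set.Iio h).indicator G s ∂expMeasure a := by
      rw [← integral_add iA iB]
      refine integral_congr_ae (Filter.Eventually.of_forall fun s => ?_)
      by_cases hs : h ≤ s
      · simp [hs, hG]
      · simp [hs, not_le.1 hs, hG]
    have hsmallI : |∫ s, (Set.Iio h).indicator G s ∂expMeasure a| ≤ k * a * h ^ 2 := by
      rw [integral_indicator measurableSet_Iio, ← Real.norm_eq_abs]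
      refine (norm_setIntegral_le_of_norm_le_const (C := k * h) (measure_lt_top _ _)
        fun s hs => ?_).trans ?_
      · refine (hsmall _).trans ?_
        have : (s.toNNReal : ℝ) ≤ h := by
          rw [Real.coe_toNNReal']
          exact max_le (le_of_lt hs) hh
        gcongr
      · calc k * h * (expMeasure a).real (Set.Iio h) ≤ k * h * (a * h) := by
              gcongr
              exact measureReal_Iio_expMeasure_le ha hh
          _ = k * a * h ^ 2 := by ring
    have iS : Integrable (fun s => G (s + h)) (expMeasure a) :=
      Integrable.of_bound ((hg.measurable.comp measurable_real_toNNReal).comp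
        (measurable_id.add_const h)).aestronglyMeasurable 1
        (Filter.Eventually.of_forall fun s => b _)
    have iC : Integrable (fun s : ℝ => Real.exp (-(k * h)) *
        (g s.toNNReal + l * h * g₁ s.toNNReal + m * h * g₂ s.toNNReal)) (expMeasure a) :=
      ((i0.add (i1.const_mul (l * h))).add (i2.const_mul (m * h))).const_mul _
    have hdiff : |∫ s, G (s + h) ∂expMeasure a - Real.exp (-(k * h)) *
        (F + l * h * F₁ + m * h * F₂)| ≤ (k * h) ^ 2 := by
      have hC : ∫ s : ℝ, Real.exp (-(k * h)) *
          (g s.toNNReal + l * h * g₁ s.toNNReal + m * h * g₂ s.toNNReal) ∂expMeasure a =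
          Real.exp (-(k * h)) * (F + l * h * F₁ + m * h * F₂) := by
        have j1 : Integrable (fun s : ℝ => l * h * g₁ s.toNNReal) (expMeasure a) := i1.const_mul _
        have j2 : Integrable (fun s : ℝ => m * h * g₂ s.toNNReal) (expMeasure a) := i2.const_mul _
        have j3 : Integrable (fun s : ℝ => g s.toNNReal + l * h * g₁ s.toNNReal) (expMeasure a) :=
          i0.add j1
        rw [integral_const_mul, integral_add j3 j2, integral_add i0 j1, integral_const_mul,
          integral_const_mul]
      rw [← hC, ← integral_sub iS iC, ← Real.norm_eq_abs, ← mul_one ((k * h) ^ 2),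
        ← probReal_univ (μ := expMeasure a)]
      refine norm_integral_le_of_norm_le_const ?_
      filter_upwards [ae_nonneg_expMeasure] with s hs
      have := hstep h.toNNReal s.toNNReal
      rw [Real.coe_toNNReal h hh, ← Real.toNNReal_add hh hs, add_comm h s] at this
      exact this
    have heq : Real.exp (a * h) * F - Real.exp (-(k * h)) * (F + l * h * F₁ + m * h * F₂) =
        Real.exp (a * h) * ∫ s, (Set.Iio h).indicator G s ∂expMeasure a +
        (∫ s, G (s + h) ∂expMeasure a - Real.exp (-(k * h)) * (F + l * h * F₁ + m * h * F₂)) := by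
      rw [hshift]
      linear_combination Real.exp (a * h) * hsplit
    rw [heq]
    refine (abs_add_le _ _).trans (add_le_add ?_ hdiff)
    rw [abs_mul, abs_of_pos (Real.exp_pos _)]
    gcongr
  -- compare the derivatives at `0`
  set Φ : ℝ → ℝ := fun h => Real.exp (a * h) * F - Real.exp (-(k * h)) *
    (F + l * h * F₁ + m * h * F₂) with hΦ
  have hder : HasDerivAt Φ ((k + a) * F - (l * F₁ + m * F₂)) 0 := by
    have d1 : HasDerivAt (fun h : ℝ => Real.exp (a * h)) (Real.exp (a * 0) * (a * 1)) 0 :=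
      ((hasDerivAt_id (0 : ℝ)).const_mul a).exp
    have d2 : HasDerivAt (fun h : ℝ => Real.exp (-(k * h))) (Real.exp (-(k * 0)) * -(k * 1)) 0 :=
      (((hasDerivAt_id (0 : ℝ)).const_mul k).neg).exp
    have d3 : HasDerivAt (fun h : ℝ => F + l * h * F₁ + m * h * F₂)
        (l * 1 * F₁ + m * 1 * F₂) 0 :=
      ((((hasDerivAt_id (0 : ℝ)).const_mul l).mul_const F₁).const_add F).add
        (((hasDerivAt_id (0 : ℝ)).const_mul m).mul_const F₂)
    convert! (d1.mul_const F).sub (d2.mul d3) using 1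
    simp
    ring
  -- The bound `hmain` holds only for `h ≥ 0`, so the vanishing derivative is one-sided; this still
  -- determines the derivative at `0`.
  have hder0 : HasDerivWithinAt Φ 0 (Set.Ici 0) 0 := by
    rw [hasDerivWithinAt_iff_isLittleO]
    have hΦ0 : Φ 0 = 0 := by simp [hΦ]
    simp only [hΦ0, sub_zero, smul_zero]
    have hO : Φ =O[nhdsWithin 0 (Set.Ici 0)] fun h : ℝ => h ^ 2 := by
      refine Asymptotics.IsBigO.of_bound (Real.exp a * (k * a) + k ^ 2) ?_
      have h1 : ∀ᶠ h : ℝ in nhdsWithin 0 (Set.Ici 0), h < 1 :=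
        nhdsWithin_le_nhds (Iio_mem_nhds one_pos)
      filter_upwards [self_mem_nhdsWithin, h1] with h hh hlt
      have hh' : (0 : ℝ) ≤ h := hh
      have he : Real.exp (a * h) ≤ Real.exp a := Real.exp_le_exp.2 (by nlinarith)
      calc ‖Φ h‖ ≤ Real.exp (a * h) * (k * a * h ^ 2) + (k * h) ^ 2 := hmain h hh'
        _ ≤ Real.exp a * (k * a * h ^ 2) + (k * h) ^ 2 := by gcongr
        _ = (Real.exp a * (k * a) + k ^ 2) * ‖h ^ 2‖ := by
            rw [Real.norm_of_nonneg (by positivity)]; ring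
    refine hO.trans_isLittleO ?_
    have := (Asymptotics.isLittleO_pow_id (𝕜 := ℝ) (n := 2) (by norm_num)).mono
      (nhdsWithin_le_nhds (s := Set.Ici (0 : ℝ)))
    exact this
  have := (uniqueDiffOn_Ici (0 : ℝ) 0 Set.self_mem_Ici).eq_deriv _ hder.hasDerivWithinAt hder0
  linarith

end ExponentialHorizon

/-! ### The recursion for the ruin probability -/

section FirstStep

variable {Ω : Type*} [MeasurableSpace Ω] {P : Measure Ω} {N D : ℝ≥0 → Ω → ℕ} {l m : ℝ≥0}
  {b w : ℕ} {t : ℝ}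

lemma expRuinProb_eq (hN : IsPoissonProcess N l P) (hD : IsPoissonProcess D m P) (u : ℝ) :
    expRuinProb P b w N D u t =
      ∫ s, pathRuinProb P b w N D u s.toNNReal ∂expMeasure (1 / t) := by
  simp only [expRuinProb, ruinProb_eq hN hD]

lemma abs_pathRuinProb_le_one [IsProbabilityMeasure P] (u : ℝ) (s : ℝ≥0) :
    |pathRuinProb P b w N D u s| ≤ 1 := by
  rw [pathRuinProb, abs_of_nonneg measureReal_nonneg]
  exact measureReal_le_one

lemma abs_expRuinProb_le_one [IsProbabilityMeasure P] (hN : IsPoissonProcess N l P)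
    (hD : IsPoissonProcess D m P) (ht : 0 < t) (u : ℝ) : |expRuinProb P b w N D u t| ≤ 1 := by
  have := isProbabilityMeasure_expMeasure (one_div_pos.2 ht)
  have h := norm_integral_le_of_norm_le_const (μ := expMeasure (1 / t)) (C := 1)
    (f := fun s => pathRuinProb P b w N D u s.toNNReal)
    (Filter.Eventually.of_forall fun s => abs_pathRuinProb_le_one u _)
  rwa [probReal_univ, mul_one, Real.norm_eq_abs, ← expRuinProb_eq hN hD] at h

lemma expRuinProb_of_neg [IsProbabilityMeasure P] (hN : IsPoissonProcess N l P)
    (hD : IsPoissonProcess D m P) (ht : 0 < t) {u : ℝ} (hu : u < 0) :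
    expRuinProb P b w N D u t = 1 := by
  have := isProbabilityMeasure_expMeasure (one_div_pos.2 ht)
  rw [expRuinProb_eq hN hD]
  simp only [pathRuinProb_of_neg hN hD hu, integral_const, probReal_univ, smul_eq_mul, mul_one]

/-- The first-step equation for the ruin probability up to an exponential time horizon. -/
lemma expRuinProb_firstStep [IsProbabilityMeasure P] (hN : IsPoissonProcess N l P)
    (hD : IsPoissonProcess D m P) (hND : IndepFun (fun ω s => N s ω) (fun ω s => D s ω) P)
    (ht : 0 < t) (hbw : w ≤ b) {u : ℝ} (hu : 0 ≤ u) :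
    ((l : ℝ) + m + 1 / t) * expRuinProb P b w N D u t =
      l * expRuinProb P b w N D (u + b - w) t + m * expRuinProb P b w N D (u - w) t := by
  simp only [expRuinProb_eq hN hD]
  refine integral_expMeasure_of_infinitesimal (one_div_pos.2 ht) (pathRuinProb_mono u)
    (pathRuinProb_mono _) (pathRuinProb_mono _) (abs_pathRuinProb_le_one u)
    (abs_pathRuinProb_le_one _) (abs_pathRuinProb_le_one _) (by positivity) (fun s => ?_)
    fun h s => abs_pathRuinProb_add_sub_le hN hD hND hbw hu h s
  rw [abs_of_nonneg (show 0 ≤ pathRuinProb P b w N D u s from measureReal_nonneg)]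
  exact pathRuinProb_le hN hD hu s

end FirstStep

end MiningPool

theorem theorem3p3 {Ω : Type*} [MeasurableSpace Ω] (P : Measure Ω) [IsProbabilityMeasure P]
    (b w : ℕ) (hw : 0 < w) (hbw : w < b)
    (lam mud : ℝ≥0) (hlam : 0 < lam) (hmud : 0 < mud) (t : ℝ) (ht : 0 < t)
    (N D : ℝ≥0 → Ω → ℕ)
    (hN : MiningPool.IsPoissonProcess N lam P) (hD : MiningPool.IsPoissonProcess D mud P)
    (hND : IndepFun (fun ω s => N s ω) (fun ω s => D s ω) P) :
    Multiset.card (MiningPool.rootsInDisk b w lam mud t) = w ∧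
    (MiningPool.rootsInDisk b w lam mud t).Nodup ∧
    ∀ x : Fin w → ℂ, Finset.univ.val.map x = MiningPool.rootsInDisk b w lam mud t →
      ∃ c : Fin w → ℂ,
        MiningPool.systemMatrix b w lam mud t x *ᵥ c = (fun _ => -((mud : ℝ) : ℂ)) ∧
        (∀ c' : Fin w → ℂ,
          MiningPool.systemMatrix b w lam mud t x *ᵥ c' = (fun _ => -((mud : ℝ) : ℂ)) →
            c' = c) ∧
        ∀ u : ℕ,
          ((MiningPool.expRuinProb P b w N D (u : ℝ) t : ℝ) : ℂ) = ∑ i, c i * x i ^ u := by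
  have hlam' : (0 : ℝ) < lam := by exact_mod_cast hlam
  have hmud' : (0 : ℝ) < mud := by exact_mod_cast hmud
  refine ⟨MiningPool.card_rootsInDisk hlam' hmud' ht,
    MiningPool.nodup_rootsInDisk hlam' hmud' ht hw hbw, fun x hx => ?_⟩
  refine MiningPool.exists_unique_coeff_of_recursion hlam' hmud' ht hw hbw hx
    (f := fun u : ℕ => MiningPool.expRuinProb P b w N D (u : ℝ) t) (B := 1)
    (fun u => MiningPool.abs_expRuinProb_le_one hN hD ht u) fun u => ?_
  rw [MiningPool.expRuinProb_firstStep hN hD hND ht hbw.le (Nat.cast_nonneg u)]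
  have h1 : ((u + (b - w) : ℕ) : ℝ) = u + b - w := by
    rw [Nat.cast_add, Nat.cast_sub hbw.le]
    ring
  rw [h1]
  congr 2
  -- For `u < w` the real capital `u - w` is negative and ruin is immediate; otherwise the natural
  -- subtraction is exact.
  split_ifs with hu
  · exact MiningPool.expRuinProb_of_neg hN hD ht (by simpa using hu)
  · rw [Nat.cast_sub (not_lt.1 hu)]
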